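/- Let $m\ge 0$ and let $f:T^m=(S^1)^m\to\mathbb{C}$, $f(z_1,\dots,z_m)=z_1+\cdots+z_m$, be the planar arm with all lengths equal to $1$, where $T^m$ carries the flat product metric. A piecewise smooth curve in $T^m$ is called horizontal if its velocity at each point $z$ is orthogonal to $\ker T_zf$. Let $U\subset\mathbb{C}$ be an open set consisting of regular values of $f$, let $b\in U$, and let $M_b=f^{-1}(b)$. The holonomy group $\mathcal{H}_b(U)$ is the group of transformations of $M_b$ of the following form, one for each piecewise smooth loop $c$ at $b$ in $U$: a point $z\in M_b$ is sent to the end point of the horizontal lift of $c$ (the horizontal curve $\tilde c$ with $f\circ\tilde c=c$) that starts at $z$. Then the fixed points of the action of $\mathcal{H}_b(U)$ on $M_b$ (the points fixed by every element of the group) are exactly the configurations $z=(z_1,\dots,z_m)\in M_b$ such that the sequence $z_1,\dots,z_m$ takes exactly two distinct values. -/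

import Mathlib

open Set
open scoped ContDiff

namespace PlanarArm

noncomputable section

/-- The planar articulated arm `f^a : T^m → ℂ` of type `a = (a_1, …, a_m)`,
`f^a(z_1, …, z_m) = ∑ a_j z_j`, on the torus `T^m = (S¹)^m` of configurations. -/
def arm {m : ℕ} (a : Fin m → ℝ) (z : Fin m → Circle) : ℂ :=
  ∑ j, (a j : ℂ) * (z j : ℂ)

/-- The Riemannian covering `ℝ^m → T^m`, `q ↦ (e^{i q_1}, …, e^{i q_m})`, of the flat torus.
Angular vectors `q` carry the Euclidean metric. -/
def config {m : ℕ} (q : EuclideanSpace ℝ (Fin m)) : Fin m → Circle :=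
  fun j => Circle.exp (q j)

/-- The arm in angular coordinates, as a map `ℝ^m → ℂ`. -/
def angularArm {m : ℕ} (a : Fin m → ℝ) (q : EuclideanSpace ℝ (Fin m)) : ℂ :=
  arm a (config q)

/-- `b` is a regular value of `f^a`: the differential of `f^a` is onto at every configuration above
`b`. The differential is read through the local diffeomorphism `config`. -/
def IsRegularValue {m : ℕ} (a : Fin m → ℝ) (b : ℂ) : Prop :=
  ∀ q : EuclideanSpace ℝ (Fin m), angularArm a q = b →
    Function.Surjective (fderiv ℝ (angularArm a) q)

/-- The horizontal space `Δ^a_q`: the orthogonal complement of the kernel of the differential of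
`f^a` at `q`, for the flat metric. -/
def horizontalSpace {m : ℕ} (a : Fin m → ℝ) (q : EuclideanSpace ℝ (Fin m)) :
    Submodule ℝ (EuclideanSpace ℝ (Fin m)) :=
  (LinearMap.ker (fderiv ℝ (angularArm a) q).toLinearMap)ᗮ

/-- `c` is continuous on `[0, T]`, and `C^∞` (up to the end points) on every closed subinterval
whose interior contains no point of the finite set `s` of break points. -/
def SmoothOffBreaks {E : Type*} [NormedAddCommGroup E] [NormedSpace ℝ E]
    (s : Finset ℝ) (T : ℝ) (c : ℝ → E) : Prop :=
  ContinuousOn c (Icc 0 T) ∧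
    ∀ x y : ℝ, 0 ≤ x → x < y → y ≤ T → (∀ t ∈ s, t ∉ Ioo x y) → ContDiffOn ℝ ∞ c (Icc x y)

/-- `c` is a piecewise smooth loop at `b` in `U`, parametrized by `[0, T]`. -/
structure IsLoop (U : Set ℂ) (b : ℂ) (T : ℝ) (c : ℝ → ℂ) : Prop where
  nonneg : 0 ≤ T
  smooth : ∃ s : Finset ℝ, SmoothOffBreaks s T c
  mapsTo : ∀ t ∈ Icc 0 T, c t ∈ U
  start : c 0 = b
  finish : c T = b

/-- `γ`, a curve in `ℝ^m` parametrized by `[0, T]`, is horizontal: it is piecewise smooth and, away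
from finitely many parameters, its velocity lies in the horizontal distribution. -/
def IsHorizontal {m : ℕ} (a : Fin m → ℝ) (T : ℝ) (γ : ℝ → EuclideanSpace ℝ (Fin m)) : Prop :=
  ∃ s : Finset ℝ, SmoothOffBreaks s T γ ∧
    ∀ t ∈ Ioo 0 T, t ∉ s → deriv γ t ∈ horizontalSpace a (γ t)

/-- A horizontal lift, starting at the configuration `z`, of the curve `c` on `[0, T]` ends at the
configuration `z'`. The lift in the torus is `t ↦ config (γ t)`. -/
def HorizontalLift {m : ℕ} (a : Fin m → ℝ) (T : ℝ) (c : ℝ → ℂ) (z z' : Fin m → Circle) : Prop :=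
  ∃ γ : ℝ → EuclideanSpace ℝ (Fin m), IsHorizontal a T γ ∧
    (∀ t ∈ Icc 0 T, arm a (config (γ t)) = c t) ∧ config (γ 0) = z ∧ config (γ T) = z'

/-- The fibre `M_b = (f^a)⁻¹(b)`. -/
abbrev Fiber {m : ℕ} (a : Fin m → ℝ) (b : ℂ) : Type :=
  {z : Fin m → Circle // arm a z = b}

/-- `φ` is the holonomy of the loop `c`: it sends each point `z` of the fibre to the end point of the
horizontal lift of `c` starting at `z`. -/
def IsHolonomy {m : ℕ} (a : Fin m → ℝ) (b : ℂ) (T : ℝ) (c : ℝ → ℂ)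
    (φ : Equiv.Perm (Fiber a b)) : Prop :=
  ∀ z : Fiber a b, HorizontalLift a T c z.1 (φ z).1

/-! ### Constant curves, concatenation and reversal -/

section Helpers

/-- Concatenation of a curve on `[0, T]` with a second curve. -/
def concat {E : Type*} (T : ℝ) (c d : ℝ → E) : ℝ → E :=
  fun t => if t ≤ T then c t else d (t - T)

lemma concat_left {E : Type*} {T : ℝ} {c d : ℝ → E} {t : ℝ} (h : t ≤ T) : concat T c d t = c t := by
  simp [concat, h]

lemma concat_right {E : Type*} {T : ℝ} {c d : ℝ → E} (hcd : c T = d 0) {t : ℝ} (h : T ≤ t) :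
    concat T c d t = d (t - T) := by
  rcases h.eq_or_lt with rfl | h
  · simp [concat, hcd]
  · simp [concat, not_le.2 h]

variable {E : Type*} [NormedAddCommGroup E] [NormedSpace ℝ E]

lemma smoothOffBreaks_const (T : ℝ) (v : E) : SmoothOffBreaks ∅ T (fun _ => v) :=
  ⟨continuousOn_const, fun _ _ _ _ _ _ => contDiffOn_const⟩

/-- Break points of a concatenation. -/
def concatBreaks (T : ℝ) (s r : Finset ℝ) : Finset ℝ :=
  s ∪ insert T (r.image (fun t => t + T))

lemma smoothOffBreaks_concat {T S : ℝ} {c d : ℝ → E} {s r : Finset ℝ}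
    (hT : 0 ≤ T) (hS : 0 ≤ S) (hcd : c T = d 0)
    (hc : SmoothOffBreaks s T c) (hd : SmoothOffBreaks r S d) :
    SmoothOffBreaks (concatBreaks T s r) (T + S) (concat T c d) := by
  constructor
  · have h1 : ContinuousOn (concat T c d) (Icc 0 T) :=
      hc.1.congr fun t ht => concat_left ht.2
    have h2 : ContinuousOn (concat T c d) (Icc T (T + S)) := by
      have : ContinuousOn (fun t => d (t - T)) (Icc T (T + S)) :=
        hd.1.comp (by fun_prop) fun t ht => ⟨by linarith [ht.1], by linarith [ht.2]⟩
      exact this.congr fun t ht => concat_right hcd ht.1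
    rw [← Icc_union_Icc_eq_Icc hT (by linarith : T ≤ T + S)]
    exact h1.union_of_isClosed h2 isClosed_Icc isClosed_Icc
  · intro x y hx hxy hy hs
    have hTs : T ∉ Ioo x y := hs T (by simp [concatBreaks])
    by_cases hyT : y ≤ T
    · refine (hc.2 x y hx hxy hyT fun t ht => hs t (by simp [concatBreaks, ht])).congr ?_
      exact fun t ht => concat_left (ht.2.trans hyT)
    · have hxT : T ≤ x := by
        by_contra h
        exact hTs ⟨not_le.1 h, not_le.1 hyT⟩
      have h1 := hd.2 (x - T) (y - T) (by linarith) (by linarith) (by linarith) (by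
        intro t ht hmem
        refine hs (t + T) (by simp [concatBreaks, ht]) ⟨?_, ?_⟩
        · linarith [hmem.1]
        · linarith [hmem.2])
      have h2 : ContDiffOn ℝ ∞ (fun t => d (t - T)) (Icc x y) :=
        h1.comp (by fun_prop) fun t ht => ⟨by linarith [ht.1], by linarith [ht.2]⟩
      exact h2.congr fun t ht => concat_right hcd (hxT.trans ht.1)

lemma deriv_concat_left {T : ℝ} {c d : ℝ → E} {t : ℝ} (h : t < T) :
    deriv (concat T c d) t = deriv c t := by
  apply Filter.EventuallyEq.deriv_eq
  filter_upwards [Iio_mem_nhds h] with u hu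
  exact concat_left (le_of_lt hu)

lemma deriv_concat_right {T : ℝ} {c d : ℝ → E} (hcd : c T = d 0) {t : ℝ} (h : T < t) :
    deriv (concat T c d) t = deriv d (t - T) := by
  rw [← deriv_comp_sub_const]
  apply Filter.EventuallyEq.deriv_eq
  filter_upwards [Ioi_mem_nhds h] with u hu
  exact concat_right hcd (le_of_lt hu)

/-- Break points of a reversed curve. -/
def reverseBreaks (T : ℝ) (s : Finset ℝ) : Finset ℝ := s.image (fun t => T - t)

lemma smoothOffBreaks_reverse {T : ℝ} {c : ℝ → E} {s : Finset ℝ}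
    (hc : SmoothOffBreaks s T c) :
    SmoothOffBreaks (reverseBreaks T s) T (fun t => c (T - t)) := by
  constructor
  · exact hc.1.comp (by fun_prop) fun t ht => ⟨by linarith [ht.2], by linarith [ht.1]⟩
  · intro x y hx hxy hy hs
    refine (hc.2 (T - y) (T - x) (by linarith) (by linarith) (by linarith) ?_).comp
      (by fun_prop) fun t ht => ⟨by linarith [ht.2], by linarith [ht.1]⟩
    intro t ht hmem
    refine hs (T - t) (Finset.mem_image_of_mem _ ht) ⟨?_, ?_⟩
    · linarith [hmem.2]
    · linarith [hmem.1]

end Helpers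

section Periodicity

variable {m : ℕ} {a : Fin m → ℝ}

lemma exists_period {p q : EuclideanSpace ℝ (Fin m)} (h : config p = config q) :
    ∃ v : EuclideanSpace ℝ (Fin m), q + v = p ∧ ∀ r, config (r + v) = config r := by
  refine ⟨p - q, by abel, fun r => ?_⟩
  funext j
  have hj : Circle.exp (p j) = Circle.exp (q j) := congrFun h j
  simp [config, Circle.exp_add, Circle.exp_sub, hj]

lemma horizontalSpace_add {v : EuclideanSpace ℝ (Fin m)}
    (hv : ∀ r : EuclideanSpace ℝ (Fin m), config (r + v) = config r)
    (q : EuclideanSpace ℝ (Fin m)) :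
    horizontalSpace a (q + v) = horizontalSpace a q := by
  have h : (fun r => angularArm a (r + v)) = angularArm a := by
    funext r
    simp [angularArm, hv]
  have h2 : fderiv ℝ (angularArm a) (q + v) = fderiv ℝ (angularArm a) q := by
    rw [← fderiv_comp_add_right, h]
  simp only [horizontalSpace, h2]

lemma horizontalLift_const {z : Fin m → Circle} {b : ℂ} (hz : arm a z = b) :
    HorizontalLift a 0 (fun _ => b) z z := by
  choose q hq using fun j => Circle.exp_surjective (z j)
  have hc : config (WithLp.toLp 2 q) = z := by
    funext j
    simp [config, hq]
  exact ⟨fun _ => WithLp.toLp 2 q, ⟨∅, smoothOffBreaks_const _ _, fun t _ _ => by simp⟩,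
    fun t _ => by rw [hc, hz], hc, hc⟩

lemma horizontalLift_concat {T S : ℝ} {c d : ℝ → ℂ} {z z' z'' : Fin m → Circle}
    (hT : 0 ≤ T) (hS : 0 ≤ S) (hcd : c T = d 0)
    (h1 : HorizontalLift a T c z z') (h2 : HorizontalLift a S d z' z'') :
    HorizontalLift a (T + S) (concat T c d) z z'' := by
  obtain ⟨γ, ⟨s, hs, hsΔ⟩, hγ, hγ0, hγT⟩ := h1
  obtain ⟨δ, ⟨r, hr, hrΔ⟩, hδ, hδ0, hδS⟩ := h2
  obtain ⟨v, hv, hper⟩ := exists_period (hγT.trans hδ0.symm)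
  have hr' : SmoothOffBreaks r S (fun t => δ t + v) :=
    ⟨hr.1.add continuousOn_const, fun x y hx hxy hy h =>
      (hr.2 x y hx hxy hy h).add contDiffOn_const⟩
  have hj : γ T = (fun t => δ t + v) 0 := hv.symm
  refine ⟨concat T γ (fun t => δ t + v),
    ⟨_, smoothOffBreaks_concat hT hS hj hs hr', ?_⟩, ?_, ?_, ?_⟩
  · intro t ht hts
    simp only [concatBreaks, Finset.mem_union, Finset.mem_insert, Finset.mem_image, not_or,
      not_exists, not_and] at hts
    obtain ⟨hts1, hts2, hts3⟩ := hts
    rcases lt_or_gt_of_ne hts2 with h | h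
    · rw [deriv_concat_left h, concat_left h.le]
      exact hsΔ t ⟨ht.1, h⟩ hts1
    · rw [deriv_concat_right hj h, concat_right hj (le_of_lt h), horizontalSpace_add hper,
        deriv_add_const]
      refine hrΔ (t - T) ⟨by linarith, by linarith [ht.2]⟩ fun hm => hts3 _ hm (by ring)
  · intro t ht
    rcases le_total t T with h | h
    · rw [concat_left h, concat_left h]
      exact hγ t ⟨ht.1, h⟩
    · rw [concat_right hj h, concat_right hcd h, hper]
      exact hδ (t - T) ⟨by linarith, by linarith [ht.2]⟩
  · rw [concat_left hT, hγ0]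
  · rw [concat_right hj (by linarith), hper, add_sub_cancel_left, hδS]

lemma horizontalLift_reverse {T : ℝ} {c : ℝ → ℂ} {z z' : Fin m → Circle}
    (h : HorizontalLift a T c z z') :
    HorizontalLift a T (fun t => c (T - t)) z' z := by
  obtain ⟨γ, ⟨s, hs, hsΔ⟩, hγ, hγ0, hγT⟩ := h
  refine ⟨fun t => γ (T - t), ⟨_, smoothOffBreaks_reverse hs, ?_⟩, ?_, by simpa using hγT,
    by simpa using hγ0⟩
  · intro t ht hts
    rw [deriv_comp_const_sub]
    refine Submodule.neg_mem _ (hsΔ (T - t) ⟨by linarith [ht.2], by linarith [ht.1]⟩ ?_)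
    exact fun hm => hts (Finset.mem_image.2 ⟨_, hm, by ring⟩)
  · intro t ht
    exact hγ (T - t) ⟨by linarith [ht.2], by linarith [ht.1]⟩

end Periodicity

/-- The holonomy group `H_b(U)`: the permutations of the fibre `M_b` that are the holonomy of some
piecewise smooth loop at `b` in `U`. It acts on `M_b` by evaluation. -/
def holonomyGroup {m : ℕ} (a : Fin m → ℝ) (U : Set ℂ) (b : ℂ) (hb : b ∈ U) :
    Subgroup (Equiv.Perm (Fiber a b)) where
  carrier := {φ | ∃ (T : ℝ) (c : ℝ → ℂ), IsLoop U b T c ∧ IsHolonomy a b T c φ}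
  one_mem' :=
    ⟨0, fun _ => b, ⟨le_rfl, ⟨∅, smoothOffBreaks_const _ _⟩, fun _ _ => hb, rfl, rfl⟩,
      fun z => horizontalLift_const z.2⟩
  mul_mem' := by
    rintro φ ψ ⟨T, c, hc, hφ⟩ ⟨S, d, hd, hψ⟩
    have hj : d S = c 0 := hd.finish.trans hc.start.symm
    obtain ⟨s, hs⟩ := hc.smooth
    obtain ⟨r, hr⟩ := hd.smooth
    refine ⟨S + T, concat S d c, ⟨add_nonneg hd.nonneg hc.nonneg,
      ⟨_, smoothOffBreaks_concat hd.nonneg hc.nonneg hj hr hs⟩, ?_, ?_, ?_⟩, fun z =>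
      horizontalLift_concat hd.nonneg hc.nonneg hj (hψ z) (hφ (ψ z))⟩
    · intro t ht
      rcases le_total t S with h | h
      · rw [concat_left h]
        exact hd.mapsTo t ⟨ht.1, h⟩
      · rw [concat_right hj h]
        exact hc.mapsTo _ ⟨by linarith, by linarith [ht.2]⟩
    · rw [concat_left hd.nonneg, hd.start]
    · rw [concat_right hj (by linarith [hc.nonneg]), add_sub_cancel_left, hc.finish]
  inv_mem' := by
    rintro φ ⟨T, c, hc, hφ⟩
    obtain ⟨s, hs⟩ := hc.smooth
    refine ⟨T, fun t => c (T - t), ⟨hc.nonneg, ⟨_, smoothOffBreaks_reverse hs⟩, ?_, ?_, ?_⟩,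
      fun z => ?_⟩
    · intro t ht
      exact hc.mapsTo (T - t) ⟨by linarith [ht.2], by linarith [ht.1]⟩
    · simpa using hc.finish
    · simpa using hc.start
    · have h := horizontalLift_reverse (hφ (φ⁻¹ z))
      have h2 : φ (φ⁻¹ z) = z := φ.apply_symm_apply z
      rwa [h2] at h

end

end PlanarArm

/-! Let `D` be the differential of the arm at `z` and `S = ∑ z_j²`. The adjoint of `D` sends `l : ℂ`
to the vector with entries `Im (l * conj z_j)`, and `D D* l = (m l - S conj l) / 2` has determinant
`gramDet z / 4`. This is positive over regular values, so there the horizontal vectors are exactly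
the `D* l`, and `covector z` recovers `l` from the planar velocity. Away from its break points a
horizontal curve therefore satisfies `z_j' = (l - z_j² conj l) / 2`, with the same `l` for every
`j`.

Two values imply fixed. Since all segments solve one scalar equation, equal segments stay equal
(`config_eq_of_isHorizontal`). The lift of a loop is then a pair `u, v` of unit vectors with `p u +
r v = c t`, for constant multiplicities `p, r > 0`. Regularity keeps `u, v` from becoming parallel,
so the sign of their oriented angle is constant. Their weighted sum and this sign determine the pair
(`circle_pair_unique`), so the lift ends where it starts.

Fixed implies two values. In a small disc around `b`, trivial holonomy around triangles makes
transport of `z` along segments a horizontal section `Z` of the arm. Its differential is `dZ_j = (L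
- Z_j² conj L) / 2` with `L = covector Z`. Symmetry of the second derivative of `Z_j` yields `β -
conj β z_j² - 2 i z_j = 0` with `β` independent of `j` (`exists_quadratic_of_horizontal_section`).
This nonzero polynomial has at most two roots, and a constant configuration would have `gramDet z =
0`. -/

namespace PlanarArm

noncomputable section

/-! ### Time-one maps of bounded vector fields -/

section Flow

variable {E : Type*} [NormedAddCommGroup E] [NormedSpace ℝ E]

lemma eqOn_of_isIntegralCurveOn {X : E → E} (hX : ContDiff ℝ 1 X) {γ δ : ℝ → E}
    (hγ : IsIntegralCurveOn γ (fun _ => X) (Icc 0 1))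
    (hδ : IsIntegralCurveOn δ (fun _ => X) (Icc 0 1)) (h0 : γ 0 = δ 0) :
    EqOn γ δ (Icc 0 1) := by
  have hcγ : ContinuousOn γ (Icc 0 1) := fun t ht => (hγ t ht).continuousWithinAt
  have hcδ : ContinuousOn δ (Icc 0 1) := fun t ht => (hδ t ht).continuousWithinAt
  obtain ⟨K, hK⟩ := (hX.locallyLipschitz.locallyLipschitzOn
    (s := γ '' Icc 0 1 ∪ δ '' Icc 0 1)).exists_lipschitzOnWith_of_compact
    ((isCompact_Icc.image_of_continuousOn hcγ).union (isCompact_Icc.image_of_continuousOn hcδ))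
  have hd : ∀ {η : ℝ → E}, IsIntegralCurveOn η (fun _ => X) (Icc 0 1) →
      ∀ t ∈ Ico (0 : ℝ) 1, HasDerivWithinAt η (X (η t)) (Ici t) t := fun {η} h t ht =>
    (h t (Ico_subset_Icc_self ht)).mono_of_mem_nhdsWithin (Icc_mem_nhdsGE_of_mem ht)
  exact ODE_solution_unique_of_mem_Icc_right (v := fun _ => X) (fun _ _ => hK) hcγ (hd hγ)
    (fun t ht => Or.inl (mem_image_of_mem _ (Ico_subset_Icc_self ht))) hcδ (hd hδ)
    (fun t ht => Or.inr (mem_image_of_mem _ (Ico_subset_Icc_self ht))) h0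

/-- In unit time a curve of speed at most `C` stays in the closed ball of radius `C`. This ball is
compact, so the field is Lipschitz there and a single application of Picard–Lindelöf reaches time
one. -/
lemma exists_isIntegralCurveOn [FiniteDimensional ℝ E] {X : E → E} (hX : ContDiff ℝ 1 X) {C : ℝ}
    (hC : ∀ q, ‖X q‖ ≤ C) (q : E) :
    ∃ γ : ℝ → E, γ 0 = q ∧ IsIntegralCurveOn γ (fun _ => X) (Icc 0 1) := by
  have : CompleteSpace E := FiniteDimensional.complete ℝ E
  have hC0 : 0 ≤ C := (norm_nonneg _).trans (hC q)
  lift C to NNReal using hC0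
  obtain ⟨K, hK⟩ := (hX.locallyLipschitz.locallyLipschitzOn
    (s := Metric.closedBall q C)).exists_lipschitzOnWith_of_compact
    (isCompact_closedBall q (C : ℝ))
  have hpl : IsPicardLindelof (fun _ => X) (⟨0, by simp⟩ : Icc (0 : ℝ) 1) q C 0 C K :=
    IsPicardLindelof.of_time_independent (fun x _ => hC x) hK (by simp)
  exact hpl.exists_eq_forall_mem_Icc_hasDerivWithinAt₀

open Classical in
/-- The time-one map of a vector field; the identity at points whose integral curve is not defined
up to time one. -/
def timeOne (X : E → E) (q : E) : E :=
  if h : ∃ γ : ℝ → E, γ 0 = q ∧ IsIntegralCurveOn γ (fun _ => X) (Icc 0 1) then h.choose 1 else q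

lemma timeOne_eq {X : E → E} (hX : ContDiff ℝ 1 X) {γ : ℝ → E}
    (hγ : IsIntegralCurveOn γ (fun _ => X) (Icc 0 1)) : timeOne X (γ 0) = γ 1 := by
  have h : ∃ δ : ℝ → E, δ 0 = γ 0 ∧ IsIntegralCurveOn δ (fun _ => X) (Icc 0 1) := ⟨γ, rfl, hγ⟩
  rw [timeOne, dif_pos h]
  exact eqOn_of_isIntegralCurveOn hX h.choose_spec.2 hγ h.choose_spec.1 (by simp)

lemma norm_sub_le_of_isIntegralCurveOn {X : E → E} {C : ℝ} (hC : ∀ q, ‖X q‖ ≤ C) {γ : ℝ → E}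
    (hγ : IsIntegralCurveOn γ (fun _ => X) (Icc 0 1)) {t : ℝ} (ht : t ∈ Icc (0 : ℝ) 1) :
    ‖γ t - γ 0‖ ≤ C := by
  have hC0 : 0 ≤ C := (norm_nonneg _).trans (hC (γ 0))
  refine ((convex_Icc (0 : ℝ) 1).norm_image_sub_le_of_norm_hasDerivWithin_le hγ
    (fun s _ => hC (γ s)) (by simp) ht).trans ?_
  simpa [abs_of_nonneg ht.1] using mul_le_of_le_one_right hC0 ht.2

variable [FiniteDimensional ℝ E]

lemma exists_isIntegralCurveOn_timeOne {X : E → E} (hX : ContDiff ℝ 1 X) {C : ℝ}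
    (hC : ∀ q, ‖X q‖ ≤ C) (q : E) :
    ∃ γ : ℝ → E, γ 0 = q ∧ γ 1 = timeOne X q ∧ IsIntegralCurveOn γ (fun _ => X) (Icc 0 1) := by
  obtain ⟨γ, h0, hγ⟩ := exists_isIntegralCurveOn hX hC q
  exact ⟨γ, h0, by rw [← h0, timeOne_eq hX hγ], hγ⟩

lemma timeOne_neg_timeOne {X : E → E} (hX : ContDiff ℝ 1 X) {C : ℝ}
    (hC : ∀ q, ‖X q‖ ≤ C) (q : E) : timeOne (fun r => -X r) (timeOne X q) = q := by
  obtain ⟨γ, h0, h1, hγ⟩ := exists_isIntegralCurveOn_timeOne hX hC q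
  have hδ : IsIntegralCurveOn (fun t => γ (1 - t)) (fun _ r => -X r) (Icc 0 1) := by
    intro t ht
    have h2 : HasDerivWithinAt (fun t : ℝ => 1 - t) (-1) (Icc 0 1) t :=
      ((hasDerivAt_id t).const_sub 1).hasDerivWithinAt
    have h3 := (hγ (1 - t) ⟨by linarith [ht.2], by linarith [ht.1]⟩).scomp t h2
      (fun s hs => ⟨by linarith [hs.2], by linarith [hs.1]⟩)
    rw [neg_one_smul] at h3
    exact h3
  have := timeOne_eq hX.neg hδ
  simpa [h0, h1] using this

/-- This equivariance lets the time-one map of a periodic field descend to the torus. -/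
lemma timeOne_add {X : E → E} (hX : ContDiff ℝ 1 X) {C : ℝ}
    (hC : ∀ q, ‖X q‖ ≤ C) {p : E} (hp : ∀ r, X (r + p) = X r) (q : E) :
    timeOne X (q + p) = timeOne X q + p := by
  obtain ⟨γ, h0, h1, hγ⟩ := exists_isIntegralCurveOn_timeOne hX hC q
  have hδ : IsIntegralCurveOn (fun t => γ t + p) (fun _ => X) (Icc 0 1) := by
    intro t ht
    simpa only [hp] using (hγ t ht).add_const p
  simpa [h0, h1] using timeOne_eq hX hδ

/-- The time-one maps of the fields `q ↦ Y q v` have derivative `Y q` at `v = 0`. -/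
lemma hasFDerivAt_timeOne {F : Type*} [NormedAddCommGroup F] [NormedSpace ℝ F]
    {Y : E → F →L[ℝ] E} (hY : ContDiff ℝ 1 Y) {C : ℝ} (hC : ∀ q, ‖Y q‖ ≤ C) (q : E) :
    HasFDerivAt (fun v => timeOne (fun r => Y r v) q) (Y q) 0 := by
  have hX : ∀ v : F, ContDiff ℝ 1 fun r => Y r v := fun v => hY.clm_apply contDiff_const
  have hB : ∀ (v : F) (r : E), ‖Y r v‖ ≤ C * ‖v‖ := fun v r => (Y r).le_of_opNorm_le (hC r) v
  have h00 : timeOne (fun r => Y r 0) q = q := by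
    have : IsIntegralCurveOn (fun _ : ℝ => q) (fun _ r => Y r 0) (Icc 0 1) := by
      intro t _
      simpa using hasDerivWithinAt_const t (Icc (0 : ℝ) 1) q
    exact timeOne_eq (hX 0) this
  rw [hasFDerivAt_iff_isLittleO_nhds_zero, Asymptotics.isLittleO_iff]
  intro ε hε
  have hcont : ∀ᶠ r in nhds q, ‖Y r - Y q‖ ≤ ε := by
    have := (hY.continuous.tendsto q).eventually (Metric.closedBall_mem_nhds (Y q) hε)
    simpa [dist_eq_norm] using this
  obtain ⟨δ, hδ, hδε⟩ := Metric.eventually_nhds_iff.1 hcont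
  have hsmall : ∀ᶠ v : F in nhds 0, C * ‖v‖ < δ := by
    have : ContinuousAt (fun v : F => C * ‖v‖) 0 := by fun_prop
    exact this.eventually_lt continuousAt_const (by simpa using hδ)
  filter_upwards [hsmall] with v hv
  obtain ⟨γ, h0, h1, hγ⟩ := exists_isIntegralCurveOn_timeOne (hX v) (hB v) q
  -- Compare the integral curve with the straight line of velocity `Y q v`. As `γ` stays within `C *
  -- ‖v‖` of `q`, the two velocities differ by at most `ε * ‖v‖`.
  have hd : ∀ t ∈ Icc (0 : ℝ) 1, HasDerivWithinAt (fun t => γ t - t • Y q v)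
      (Y (γ t) v - Y q v) (Icc 0 1) t := fun t ht => by
    simpa using (hγ t ht).fun_sub (((hasDerivAt_id t).smul_const (Y q v)).hasDerivWithinAt)
  have hb : ∀ t ∈ Icc (0 : ℝ) 1, ‖Y (γ t) v - Y q v‖ ≤ ε * ‖v‖ := by
    intro t ht
    have hdist : dist (γ t) q < δ := by
      rw [dist_eq_norm, ← h0]
      exact (norm_sub_le_of_isIntegralCurveOn (hB v) hγ ht).trans_lt hv
    exact (Y (γ t) - Y q).le_of_opNorm_le (hδε hdist) v
  have := (convex_Icc (0 : ℝ) 1).norm_image_sub_le_of_norm_hasDerivWithin_le hd hb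
    (left_mem_Icc.2 zero_le_one) (right_mem_Icc.2 zero_le_one)
  simp only [zero_add, h00, ← h1]
  simpa [h0, sub_right_comm] using this

end Flow

/-! ### Horizontal vectors of the arm with unit lengths -/

section UnitArm

open ComplexConjugate

variable {m : ℕ}

/-- The lengths of the arm all of whose segments have length `1`. -/
abbrev unitLengths (m : ℕ) : Fin m → ℝ := fun _ => 1

lemma unitArm_apply (z : Fin m → Circle) : arm (unitLengths m) z = ∑ j, (z j : ℂ) := by
  simp [arm]

/-- The sum of the squares of a configuration. -/
def squareSum (z : Fin m → Circle) : ℂ := ∑ j, (z j : ℂ) ^ 2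

/-- Four times the determinant of `D ∘ D*`, where `D` is the differential of the unit arm. -/
def gramDet (z : Fin m → Circle) : ℝ := (m : ℝ) ^ 2 - Complex.normSq (squareSum z)

/-- The value at `l` of the adjoint of the differential of the unit arm at `z`. -/
def horizontalVector (z : Fin m → Circle) : ℂ →L[ℝ] EuclideanSpace ℝ (Fin m) :=
  LinearMap.toContinuousLinearMap
    { toFun := fun l => WithLp.toLp 2 fun j => (l * conj (z j : ℂ)).im
      map_add' := fun l l' => by ext j; simp; ring
      map_smul' := fun r l => by ext j; simp; ring }

lemma horizontalVector_apply (z : Fin m → Circle) (l : ℂ) (j : Fin m) :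
    horizontalVector z l j = (l * conj (z j : ℂ)).im := rfl

/-- The inverse of `D ∘ D*`, where `D` is the differential of the unit arm at `z`. -/
def covector (z : Fin m → Circle) : ℂ →L[ℝ] ℂ :=
  LinearMap.toContinuousLinearMap
    { toFun := fun w => (2 / gramDet z) • ((m : ℂ) * w + squareSum z * conj w)
      map_add' := fun w w' => by simp only [map_add, ← smul_add]; congr 1; ring
      map_smul' := fun r w => by
        simp only [Complex.real_smul, map_mul, Complex.conj_ofReal, RingHom.id_apply]; ring }

lemma covector_apply (z : Fin m → Circle) (w : ℂ) :
    covector z w = (2 / gramDet z) • ((m : ℂ) * w + squareSum z * conj w) := rfl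

/-- The differential of the unit arm. -/
def armDeriv (q : EuclideanSpace ℝ (Fin m)) : EuclideanSpace ℝ (Fin m) →L[ℝ] ℂ :=
  ∑ j, (EuclideanSpace.proj j : EuclideanSpace ℝ (Fin m) →L[ℝ] ℝ).smulRight
    (Complex.I * (config q j : ℂ))

lemma armDeriv_apply (q h : EuclideanSpace ℝ (Fin m)) :
    armDeriv q h = ∑ j, (h j : ℂ) * (Complex.I * (config q j : ℂ)) := by
  simp [armDeriv]

lemma coe_circle_mul_conj (z : Circle) : (z : ℂ) * conj (z : ℂ) = 1 := by
  rw [Complex.mul_conj]; simp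

lemma hasFDerivAt_coe_config (q : EuclideanSpace ℝ (Fin m)) (j : Fin m) :
    HasFDerivAt (fun r : EuclideanSpace ℝ (Fin m) => (config r j : ℂ))
      ((EuclideanSpace.proj j : EuclideanSpace ℝ (Fin m) →L[ℝ] ℝ).smulRight
        (Complex.I * (config q j : ℂ))) q := by
  have h1 : HasDerivAt (fun t : ℝ => Complex.exp (t * Complex.I))
      (Complex.exp (q j * Complex.I) * Complex.I) (q j) := by
    simpa using ((hasDerivAt_id (q j)).ofReal_comp.mul_const Complex.I).cexp
  have h2 : HasFDerivAt (fun r : EuclideanSpace ℝ (Fin m) => r j)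
      (EuclideanSpace.proj j : EuclideanSpace ℝ (Fin m) →L[ℝ] ℝ) q :=
    (EuclideanSpace.proj j : EuclideanSpace ℝ (Fin m) →L[ℝ] ℝ).hasFDerivAt
  have h3 := h1.hasFDerivAt.comp q h2
  refine h3.congr_fderiv ?_
  ext h
  simp [config, Circle.coe_exp, mul_comm]

lemma hasFDerivAt_angularArm (q : EuclideanSpace ℝ (Fin m)) :
    HasFDerivAt (angularArm (unitLengths m)) (armDeriv q) q := by
  have : angularArm (unitLengths m) = fun r => ∑ j, (config r j : ℂ) := by
    funext r; exact unitArm_apply _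
  rw [this]
  exact HasFDerivAt.fun_sum fun j _ => hasFDerivAt_coe_config q j

lemma contDiff_coe_config (j : Fin m) :
    ContDiff ℝ ∞ (fun r : EuclideanSpace ℝ (Fin m) => (config r j : ℂ)) := by
  simp only [config, Circle.coe_exp]
  have : ContDiff ℝ ∞ (fun r : EuclideanSpace ℝ (Fin m) => ((r j : ℝ) : ℂ)) :=
    Complex.ofRealCLM.contDiff.comp
      (EuclideanSpace.proj j : EuclideanSpace ℝ (Fin m) →L[ℝ] ℝ).contDiff
  exact (this.mul contDiff_const).cexp

lemma contDiff_angularArm : ContDiff ℝ ∞ (angularArm (unitLengths m)) := by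
  have : angularArm (unitLengths m) = fun r => ∑ j, (config r j : ℂ) := by
    funext r; exact unitArm_apply _
  rw [this]
  exact ContDiff.sum fun j _ => contDiff_coe_config j

lemma contDiff_squareSum :
    ContDiff ℝ ∞ (fun r : EuclideanSpace ℝ (Fin m) => squareSum (config r)) :=
  ContDiff.sum fun j _ => (contDiff_coe_config j).pow 2

lemma contDiff_gramDet :
    ContDiff ℝ ∞ (fun r : EuclideanSpace ℝ (Fin m) => gramDet (config r)) := by
  simp only [gramDet, Complex.normSq_eq_norm_sq]
  exact contDiff_const.sub (contDiff_squareSum.norm_sq ℝ)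

lemma horizontalVector_mul_I_mul (z : Fin m → Circle) (l : ℂ) (j : Fin m) :
    ((horizontalVector z l j : ℝ) : ℂ) * (Complex.I * (z j : ℂ))
      = (l - (z j : ℂ) ^ 2 * conj l) / 2 := by
  have h1 : (((l * conj (z j : ℂ)).im : ℝ) : ℂ) * Complex.I
      = (l * conj (z j : ℂ) - conj l * (z j : ℂ)) / 2 := by
    apply Complex.ext <;> simp
    ring
  rw [horizontalVector_apply, ← mul_assoc, h1]
  linear_combination (l / 2) * coe_circle_mul_conj (z j)

lemma armDeriv_horizontalVector (q : EuclideanSpace ℝ (Fin m)) (l : ℂ) :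
    armDeriv q (horizontalVector (config q) l)
      = ((m : ℂ) * l - squareSum (config q) * conj l) / 2 := by
  rw [armDeriv_apply, Finset.sum_congr rfl fun j _ => horizontalVector_mul_I_mul _ l j,
    ← Finset.sum_div, Finset.sum_sub_distrib, ← Finset.sum_mul]
  simp [squareSum]

lemma inner_horizontalVector (q h : EuclideanSpace ℝ (Fin m)) (l : ℂ) :
    inner ℝ h (horizontalVector (config q) l) = (conj l * armDeriv q h).re := by
  rw [armDeriv_apply, Finset.mul_sum, Complex.re_sum, PiLp.inner_apply]
  refine Finset.sum_congr rfl fun j _ => ?_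
  simp [horizontalVector_apply]
  ring

/-- With `σ` complex conjugation, `(m - S σ)(m + S σ) = m² - |S|²` as real-linear maps, because `S σ
S σ` is multiplication by `S conj S`. -/
lemma covector_left_inv {z : Fin m → Circle} (hz : gramDet z ≠ 0) (w : ℂ) :
    ((m : ℂ) * covector z w - squareSum z * conj (covector z w)) / 2 = w := by
  have hz' : (gramDet z : ℂ) ≠ 0 := by exact_mod_cast hz
  have hS : squareSum z * conj (squareSum z) = (m : ℂ) ^ 2 - gramDet z := by
    rw [Complex.mul_conj, gramDet]; push_cast; ring
  simp only [covector_apply, Complex.real_smul, map_mul, map_add, map_div₀,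
    Complex.conj_ofReal, Complex.conj_conj, Complex.ofReal_div, map_natCast, Complex.ofReal_ofNat,
    map_ofNat]
  field_simp
  linear_combination (-w) * hS

lemma covector_right_inv {z : Fin m → Circle} (hz : gramDet z ≠ 0) (l : ℂ) :
    covector z (((m : ℂ) * l - squareSum z * conj l) / 2) = l := by
  have hz' : (gramDet z : ℂ) ≠ 0 := by exact_mod_cast hz
  have hS : squareSum z * conj (squareSum z) = (m : ℂ) ^ 2 - gramDet z := by
    rw [Complex.mul_conj, gramDet]; push_cast; ring
  simp only [covector_apply, Complex.real_smul, map_mul, map_sub, map_div₀,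
    Complex.conj_conj, Complex.ofReal_div, map_natCast, Complex.ofReal_ofNat, map_ofNat]
  field_simp
  linear_combination (-l) * hS

lemma armDeriv_horizontalVector_covector {q : EuclideanSpace ℝ (Fin m)}
    (hq : gramDet (config q) ≠ 0) (w : ℂ) :
    armDeriv q (horizontalVector (config q) (covector (config q) w)) = w := by
  rw [armDeriv_horizontalVector, covector_left_inv hq]

lemma horizontalVector_mem (q : EuclideanSpace ℝ (Fin m)) (l : ℂ) :
    horizontalVector (config q) l ∈ horizontalSpace (unitLengths m) q := by
  rw [horizontalSpace, (hasFDerivAt_angularArm q).fderiv, Submodule.mem_orthogonal]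
  intro h hh
  have : armDeriv q h = 0 := hh
  rw [inner_horizontalVector, this]
  simp

/-- The difference of the two sides is horizontal and lies in the kernel of the differential, so it
is orthogonal to itself. -/
lemma eq_horizontalVector_of_mem {q g : EuclideanSpace ℝ (Fin m)}
    (hq : gramDet (config q) ≠ 0) (hg : g ∈ horizontalSpace (unitLengths m) q) :
    g = horizontalVector (config q) (covector (config q) (armDeriv q g)) := by
  set g' := horizontalVector (config q) (covector (config q) (armDeriv q g)) with hg'
  have h1 : g - g' ∈ horizontalSpace (unitLengths m) q :=
    Submodule.sub_mem _ hg (horizontalVector_mem q _)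
  have h2 : armDeriv q (g - g') = 0 := by
    rw [map_sub, hg', armDeriv_horizontalVector_covector hq, sub_self]
  rw [horizontalSpace, (hasFDerivAt_angularArm q).fderiv, Submodule.mem_orthogonal] at h1
  exact sub_eq_zero.1 (inner_self_eq_zero.1 (h1 _ h2))

lemma config_surjective : Function.Surjective (config (m := m)) := by
  intro z
  choose q hq using fun j => Circle.exp_surjective (z j)
  exact ⟨WithLp.toLp 2 q, funext fun j => by simp [config, hq]⟩

lemma norm_squareSum_le (z : Fin m → Circle) : ‖squareSum z‖ ≤ m := by
  refine (norm_sum_le _ _).trans ?_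
  simp [Circle.norm_coe]

lemma gramDet_nonneg (z : Fin m → Circle) : 0 ≤ gramDet z := by
  rw [gramDet, Complex.normSq_eq_norm_sq]
  nlinarith [norm_squareSum_le z, norm_nonneg (squareSum z)]

/-- A configuration over a regular value is not collinear. -/
lemma gramDet_pos_of_isRegularValue {w : ℂ} (hw : IsRegularValue (unitLengths m) w)
    {z : Fin m → Circle} (hz : arm (unitLengths m) z = w) : 0 < gramDet z := by
  refine (gramDet_nonneg z).lt_of_ne' fun h0 => ?_
  obtain ⟨q, rfl⟩ := config_surjective z
  have hsurj := hw q hz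
  rw [(hasFDerivAt_angularArm q).fderiv] at hsurj
  have hS : squareSum (config q) * conj (squareSum (config q)) = (m : ℂ) ^ 2 := by
    have : Complex.normSq (squareSum (config q)) = (m : ℝ) ^ 2 := by
      rw [gramDet] at h0; linarith
    rw [Complex.mul_conj, this]; push_cast; ring
  have key : ∀ l : ℂ, (m : ℂ) * l - squareSum (config q) * conj l = 0 → l = 0 := by
    intro l hl
    have h1 : horizontalVector (config q) l = 0 := by
      rw [← inner_self_eq_zero (𝕜 := ℝ), inner_horizontalVector, armDeriv_horizontalVector, hl]
      simp
    obtain ⟨h, hh⟩ := hsurj l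
    have h2 := inner_horizontalVector q h l
    have hh' : armDeriv q h = l := hh
    rw [h1, inner_zero_right, hh', ← Complex.normSq_eq_conj_mul_self, Complex.ofReal_re] at h2
    exact Complex.normSq_eq_zero.1 h2.symm
  -- When `|S| = m`, both `m + S` and `i (m - S)` are killed by `l ↦ m l - S conj l`. If both
  -- vanish, then `m = S = 0` and the map is zero, so `l = 1` gives the contradiction; this is the
  -- case of the empty arm.
  have k1 := key ((m : ℂ) + squareSum (config q)) (by
    simp only [map_add, map_natCast]; linear_combination -hS)
  have k2 := key (Complex.I * (m - squareSum (config q))) (by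
    simp only [map_mul, map_sub, map_natCast, Complex.conj_I]; linear_combination Complex.I * -hS)
  have k3 : (m : ℂ) = 0 := by
    rw [mul_eq_zero, or_iff_right Complex.I_ne_zero] at k2
    linear_combination (k1 + k2) / 2
  have k4 : squareSum (config q) = 0 := by linear_combination k1 - k3
  exact one_ne_zero (key 1 (by rw [k3, k4]; simp))

end UnitArm

/-! ### Configurations with two values are fixed -/

section TwoValues

open ComplexConjugate

variable {m : ℕ}

/-- Induction on the number of break points in `(0, t)`: the last of them is reached by induction,
and no break point separates it from `t`. -/
lemma forall_mem_Icc_of_breaks {R : ℝ → Prop} {T : ℝ} (s : Finset ℝ)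
    (h : ∀ x y, 0 ≤ x → x < y → y ≤ T → (∀ t ∈ s, t ∉ Ioo x y) → R x → R y) (h0 : R 0) :
    ∀ t ∈ Icc 0 T, R t := by
  suffices H : ∀ n t, t ∈ Icc 0 T → (s.filter fun r => 0 < r ∧ r < t).card = n → R t from
    fun t ht => H _ t ht rfl
  intro n
  induction n using Nat.strong_induction_on with
  | _ n ih =>
    intro t ht hn
    rcases ht.1.eq_or_lt with rfl | htpos
    · exact h0
    rcases (s.filter fun r => 0 < r ∧ r < t).eq_empty_or_nonempty with he | hne
    · refine h 0 t le_rfl htpos ht.2 (fun r hr hrt => ?_) h0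
      exact Finset.notMem_empty r (he ▸ Finset.mem_filter.2 ⟨hr, hrt⟩)
    · obtain ⟨x, hx, hmax⟩ := (s.filter fun r => 0 < r ∧ r < t).exists_max_image id hne
      obtain ⟨hxs, hx0, hxt⟩ := Finset.mem_filter.1 hx
      have hlt : (s.filter fun r => 0 < r ∧ r < x).card < n := by
        rw [← hn]
        refine Finset.card_lt_card (Finset.ssubset_iff_subset_ne.2 ⟨fun r hr => ?_, fun he => ?_⟩)
        · obtain ⟨h1, h2, h3⟩ := Finset.mem_filter.1 hr
          exact Finset.mem_filter.2 ⟨h1, h2, h3.trans hxt⟩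
        · rw [← he] at hx
          exact lt_irrefl _ (Finset.mem_filter.1 hx).2.2
      refine h x t hx0.le hxt ht.2 (fun r hr hrt => ?_)
        (ih _ hlt x ⟨hx0.le, hxt.le.trans ht.2⟩ rfl)
      exact absurd (hmax r (Finset.mem_filter.2 ⟨hr, hx0.trans hrt.1, hrt.2⟩)) (not_le.2 hrt.1)

lemma hasDerivAt_coe_config {γ : ℝ → EuclideanSpace ℝ (Fin m)} {t : ℝ} {l : ℂ}
    (h : HasDerivAt γ (horizontalVector (config (γ t)) l) t) (j : Fin m) :
    HasDerivAt (fun t => (config (γ t) j : ℂ)) ((l - (config (γ t) j : ℂ) ^ 2 * conj l) / 2) t := by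
  rw [← horizontalVector_mul_I_mul]
  exact (hasFDerivAt_coe_config (γ t) j).comp_hasDerivAt t h

/-- A bound of Grönwall type, for derivatives on the open interval. -/
lemma eq_zero_of_norm_deriv_le {d d' : ℝ → ℂ} {x y K : ℝ} (hxy : x ≤ y)
    (hc : ContinuousOn d (Icc x y)) (hd : ∀ t ∈ Ioo x y, HasDerivAt d (d' t) t)
    (hb : ∀ t ∈ Ioo x y, ‖d' t‖ ≤ K * ‖d t‖) (h0 : d x = 0) : d y = 0 := by
  -- The integrating factor makes `‖d‖²` times it nonincreasing; it is nonnegative and starts at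
  -- zero.
  have hderiv : ∀ t ∈ Ioo x y, HasDerivAt (fun t => ‖d t‖ ^ 2 * Real.exp (-(2 * K * t)))
      (2 * inner ℝ (d t) (d' t) * Real.exp (-(2 * K * t))
        + ‖d t‖ ^ 2 * (Real.exp (-(2 * K * t)) * -(2 * K))) t := by
    intro t ht
    have h2 : HasDerivAt (fun t => -(2 * K * t)) (-(2 * K)) t := by
      simpa using ((hasDerivAt_id t).const_mul (2 * K)).fun_neg
    exact (hd t ht).norm_sq.mul h2.exp
  have hanti : AntitoneOn (fun t => ‖d t‖ ^ 2 * Real.exp (-(2 * K * t))) (Icc x y) := by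
    refine antitoneOn_of_deriv_nonpos (convex_Icc x y) ?_ ?_ ?_
    · exact (hc.norm.pow 2).mul (by fun_prop)
    · rw [interior_Icc]
      exact fun t ht => (hderiv t ht).differentiableAt.differentiableWithinAt
    · rw [interior_Icc]
      intro t ht
      rw [(hderiv t ht).deriv]
      have h1 : inner ℝ (d t) (d' t) ≤ K * ‖d t‖ ^ 2 := by
        refine (real_inner_le_norm _ _).trans ?_
        nlinarith [hb t ht, norm_nonneg (d t)]
      nlinarith [Real.exp_pos (-(2 * K * t))]
  have := hanti (left_mem_Icc.2 hxy) (right_mem_Icc.2 hxy) hxy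
  simp only [h0, norm_zero, ne_eq, OfNat.ofNat_ne_zero, not_false_eq_true, zero_pow,
    zero_mul] at this
  have h3 := nonpos_of_mul_nonpos_left this (Real.exp_pos _)
  exact norm_eq_zero.1 (pow_eq_zero_iff two_ne_zero |>.1 (le_antisymm h3 (sq_nonneg _)))

/-- The difference `d = z_j - z_k` satisfies the linear equation `d' = -conj l * ((z_j + z_k) / 2) *
d`, so `‖d'‖ ≤ ‖l‖ * ‖d‖`. Smoothness up to the end points bounds `l` on the compact interval. -/
lemma config_eq_of_contDiffOn {γ : ℝ → EuclideanSpace ℝ (Fin m)} {x y : ℝ} (hxy : x < y)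
    (hγ : ContDiffOn ℝ ∞ γ (Icc x y))
    (hh : ∀ t ∈ Ioo x y, deriv γ t ∈ horizontalSpace (unitLengths m) (γ t))
    (hg : ∀ t ∈ Icc x y, gramDet (config (γ t)) ≠ 0) {j k : Fin m}
    (hjk : config (γ x) j = config (γ x) k) : config (γ y) j = config (γ y) k := by
  have hc : ContinuousOn γ (Icc x y) := hγ.continuousOn
  have hcj : ∀ i, ContinuousOn (fun t => (config (γ t) i : ℂ)) (Icc x y) := fun i =>
    (contDiff_coe_config i).continuous.comp_continuousOn hc
  -- The one-sided derivative is used because `deriv γ` is not controlled at the end points.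
  have hv : ContinuousOn (derivWithin γ (Icc x y)) (Icc x y) :=
    hγ.continuousOn_derivWithin (uniqueDiffOn_Icc hxy) (by simp)
  set w : ℝ → ℂ := fun t => armDeriv (γ t) (derivWithin γ (Icc x y) t) with hw
  have hwc : ContinuousOn w (Icc x y) := by
    simp only [hw, armDeriv_apply]
    refine continuousOn_finsetSum _ fun i _ => ?_
    have : ContinuousOn (fun t => derivWithin γ (Icc x y) t i) (Icc x y) :=
      (EuclideanSpace.proj i : EuclideanSpace ℝ (Fin m) →L[ℝ] ℝ).continuous.comp_continuousOn hv
    exact (Complex.continuous_ofReal.comp_continuousOn this).mul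
      (continuousOn_const.mul (hcj i))
  have hlc : ContinuousOn (fun t => covector (config (γ t)) (w t)) (Icc x y) := by
    simp only [covector_apply]
    have h1 : ContinuousOn (fun t => gramDet (config (γ t))) (Icc x y) :=
      contDiff_gramDet.continuous.comp_continuousOn hc
    have h2 : ContinuousOn (fun t => squareSum (config (γ t))) (Icc x y) :=
      contDiff_squareSum.continuous.comp_continuousOn hc
    exact (continuousOn_const.div h1 hg).smul ((continuousOn_const.mul hwc).add
      (h2.mul (Complex.continuous_conj.comp_continuousOn hwc)))
  obtain ⟨K, hK⟩ := isCompact_Icc.exists_bound_of_continuousOn hlc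
  have hd : ∀ t ∈ Ioo x y, HasDerivAt γ
      (horizontalVector (config (γ t)) (covector (config (γ t)) (w t))) t := by
    intro t ht
    have h1 : DifferentiableAt ℝ γ t :=
      ((hγ t (Ioo_subset_Icc_self ht)).contDiffAt (Icc_mem_nhds ht.1 ht.2)).differentiableAt
        (by simp)
    have h2 : derivWithin γ (Icc x y) t = deriv γ t :=
      derivWithin_of_mem_nhds (Icc_mem_nhds ht.1 ht.2)
    simp only [hw, h2]
    rw [← eq_horizontalVector_of_mem (hg t (Ioo_subset_Icc_self ht)) (hh t ht)]
    exact h1.hasDerivAt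
  have := eq_zero_of_norm_deriv_le (d := fun t => (config (γ t) j : ℂ) - (config (γ t) k : ℂ))
    (K := K) hxy.le ((hcj j).sub (hcj k))
    (fun t ht => (hasDerivAt_coe_config (hd t ht) j).sub (hasDerivAt_coe_config (hd t ht) k))
    (fun t ht => ?_) (by simp [hjk])
  · exact Circle.ext (sub_eq_zero.1 this)
  · set l := covector (config (γ t)) (w t) with hl
    have h1 : (l - (config (γ t) j : ℂ) ^ 2 * conj l) / 2
        - (l - (config (γ t) k : ℂ) ^ 2 * conj l) / 2
        = -(conj l * ((config (γ t) j + config (γ t) k) / 2))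
          * ((config (γ t) j : ℂ) - config (γ t) k) := by ring
    have h2 : ‖((config (γ t) j : ℂ) + config (γ t) k) / 2‖ ≤ 1 := by
      rw [norm_div, RCLike.norm_ofNat, div_le_one two_pos]
      refine (norm_add_le _ _).trans ?_
      norm_num [Circle.norm_coe]
    rw [h1, norm_mul, norm_neg, norm_mul, RCLike.norm_conj]
    refine mul_le_mul_of_nonneg_right ?_ (norm_nonneg _)
    exact (mul_le_of_le_one_right (norm_nonneg _) h2).trans (hK t (Ioo_subset_Icc_self ht))

/-- Segments that are parallel stay parallel along a horizontal curve. -/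
lemma config_eq_of_isHorizontal {γ : ℝ → EuclideanSpace ℝ (Fin m)} {T : ℝ}
    (hγ : IsHorizontal (unitLengths m) T γ)
    (hg : ∀ t ∈ Icc 0 T, gramDet (config (γ t)) ≠ 0) {j k : Fin m}
    (hjk : config (γ 0) j = config (γ 0) k) :
    ∀ t ∈ Icc 0 T, config (γ t) j = config (γ t) k := by
  obtain ⟨s, hs, hh⟩ := hγ
  refine forall_mem_Icc_of_breaks s (fun x y hx hxy hy hxs => ?_) hjk
  refine config_eq_of_contDiffOn hxy (hs.2 x y hx hxy hy hxs) (fun t ht => ?_) fun t ht =>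
    hg t ⟨hx.trans ht.1, ht.2.trans hy⟩
  exact hh t ⟨hx.trans_lt ht.1, ht.2.trans_le hy⟩ fun hts => hxs t hts ht

lemma gramDet_eq_zero_of_sq_eq {z : Fin m → Circle} {c : Circle}
    (h : ∀ j, (z j : ℂ) ^ 2 = (c : ℂ) ^ 2) : gramDet z = 0 := by
  rw [gramDet, squareSum, Finset.sum_congr rfl fun j _ => h j]
  simp [Complex.normSq_eq_norm_sq, Circle.norm_coe]

lemma sq_eq_sq_of_im_mul_conj_eq_zero {u v : Circle} (h : ((v : ℂ) * conj (u : ℂ)).im = 0) :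
    (v : ℂ) ^ 2 = (u : ℂ) ^ 2 := by
  have h1 : conj ((v : ℂ) * conj (u : ℂ)) = v * conj (u : ℂ) := Complex.conj_eq_iff_im.2 h
  rw [map_mul, Complex.conj_conj] at h1
  linear_combination (-(v : ℂ) * u) * h1 + (u : ℂ) ^ 2 * coe_circle_mul_conj v
    - (v : ℂ) ^ 2 * coe_circle_mul_conj u

/-- Two unit vectors whose positive combination has a given value are determined by the sign of
their oriented angle. -/
lemma circle_pair_unique {p r : ℝ} (hp : 0 < p) (hr : 0 < r) {u v u' v' : Circle}
    (h : (p : ℂ) * u + r * v = p * u' + r * v')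
    (hs : 0 < ((v : ℂ) * conj (u : ℂ)).im * ((v' : ℂ) * conj (u' : ℂ)).im) : u = u' ∧ v = v' := by
  -- Law of cosines: the modulus of the sum fixes the cosine of the angle, and the sign hypothesis
  -- then fixes its sine.
  have expand : ∀ a b : Circle, Complex.normSq ((p : ℂ) * a + r * b)
      = p ^ 2 + r ^ 2 + 2 * (p * r) * ((b : ℂ) * conj (a : ℂ)).re := by
    intro a b
    have ha : (a : ℂ).re * (a : ℂ).re + (a : ℂ).im * (a : ℂ).im = 1 := Circle.normSq_coe a
    have hb : (b : ℂ).re * (b : ℂ).re + (b : ℂ).im * (b : ℂ).im = 1 := Circle.normSq_coe b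
    simp only [Complex.normSq_apply, Complex.add_re, Complex.add_im, Complex.mul_re, Complex.mul_im,
      Complex.ofReal_re, Complex.ofReal_im, Complex.conj_re, Complex.conj_im]
    linear_combination p ^ 2 * ha + r ^ 2 * hb
  have unit : ∀ a b : Circle, ((b : ℂ) * conj (a : ℂ)).re ^ 2 + ((b : ℂ) * conj (a : ℂ)).im ^ 2
      = 1 := by
    intro a b
    have : Complex.normSq ((b : ℂ) * conj (a : ℂ)) = 1 := by simp
    rw [Complex.normSq_apply] at this
    linarith
  have hre : ((v : ℂ) * conj (u : ℂ)).re = ((v' : ℂ) * conj (u' : ℂ)).re := by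
    have h1 := expand u v
    rw [h, expand u' v'] at h1
    have : (p * r) * (((v : ℂ) * conj (u : ℂ)).re - ((v' : ℂ) * conj (u' : ℂ)).re) = 0 := by
      linarith
    exact sub_eq_zero.1 ((mul_eq_zero.1 this).resolve_left (mul_pos hp hr).ne')
  have him : ((v : ℂ) * conj (u : ℂ)).im = ((v' : ℂ) * conj (u' : ℂ)).im := by
    have h1 := unit u v
    rw [hre] at h1
    rcases sq_eq_sq_iff_eq_or_eq_neg.1 (add_left_cancel (h1.trans (unit u' v').symm)) with h2 | h2
    · exact h2
    · rw [h2] at hs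
      nlinarith [sq_nonneg ((v' : ℂ) * conj (u' : ℂ)).im]
  have ha : (v : ℂ) * conj (u : ℂ) = (v' : ℂ) * conj (u' : ℂ) := Complex.ext hre him
  set a := (v' : ℂ) * conj (u' : ℂ) with hadef
  have hv : (v : ℂ) = a * u := by
    linear_combination (u : ℂ) * ha - (v : ℂ) * coe_circle_mul_conj u
  have hv' : (v' : ℂ) = a * u' := by
    linear_combination (u' : ℂ) * hadef.symm - (v' : ℂ) * coe_circle_mul_conj u'
  -- The sum is `(p + r a) u` with `a = v conj u` already determined; `a` is not real, so the factor
  -- can be cancelled.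
  have hne : (p : ℂ) + r * a ≠ 0 := by
    intro h0
    have h1 := congrArg Complex.im h0
    simp only [Complex.add_im, Complex.ofReal_im, Complex.mul_im, Complex.ofReal_re, zero_mul,
      zero_add, add_zero, Complex.zero_im] at h1
    rw [(mul_eq_zero.1 h1).resolve_left hr.ne', mul_zero] at hs
    exact lt_irrefl _ hs
  have hu : (u : ℂ) = u' := by
    refine mul_left_cancel₀ hne ?_
    rw [hv, hv'] at h
    linear_combination h
  exact ⟨Circle.ext hu, Circle.ext (by rw [hv, hv', hu])⟩

lemma mul_pos_of_continuousOn_of_ne_zero {g : ℝ → ℝ} {T : ℝ} (hT : 0 ≤ T)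
    (hg : ContinuousOn g (Icc 0 T)) (h0 : ∀ t ∈ Icc 0 T, g t ≠ 0) : 0 < g 0 * g T := by
  have ha := h0 0 (left_mem_Icc.2 hT)
  have hb := h0 T (right_mem_Icc.2 hT)
  refine (mul_ne_zero ha hb).symm.lt_of_le (le_of_not_gt fun hneg => ?_)
  rcases mul_neg_iff.1 hneg with ⟨h1, h2⟩ | ⟨h1, h2⟩
  · obtain ⟨t, ht, hgt⟩ := intermediate_value_Icc' hT hg ⟨h2.le, h1.le⟩
    exact h0 t ht hgt
  · obtain ⟨t, ht, hgt⟩ := intermediate_value_Icc hT hg ⟨h1.le, h2.le⟩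
    exact h0 t ht hgt

lemma eq_of_horizontalLift_of_ncard_eq_two {U : Set ℂ}
    (hreg : ∀ w ∈ U, IsRegularValue (unitLengths m) w) {b : ℂ} {T : ℝ} {c : ℝ → ℂ}
    (hc : IsLoop U b T c) {z z' : Fin m → Circle} (hz : (range z).ncard = 2)
    (h : HorizontalLift (unitLengths m) T c z z') : z' = z := by
  obtain ⟨γ, hγ, hlift, rfl, rfl⟩ := h
  have hT := hc.nonneg
  have hg : ∀ t ∈ Icc 0 T, gramDet (config (γ t)) ≠ 0 := fun t ht =>
    (gramDet_pos_of_isRegularValue (hreg _ (hc.mapsTo t ht)) (hlift t ht)).ne'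
  obtain ⟨u, v, huv, hrange⟩ := ncard_eq_two.1 hz
  obtain ⟨j, hj⟩ : u ∈ range (config (γ 0)) := hrange ▸ mem_insert _ _
  obtain ⟨k, hk⟩ : v ∈ range (config (γ 0)) := hrange ▸ mem_insert_of_mem _ rfl
  have hval : ∀ i, config (γ 0) i ≠ u → config (γ 0) i = v := fun i hi => by
    have : config (γ 0) i ∈ ({u, v} : Set Circle) := hrange ▸ mem_range_self i
    exact this.resolve_left hi
  classical
  set A := Finset.univ.filter fun i => config (γ 0) i = u with hA
  set B := Finset.univ.filter fun i => ¬ config (γ 0) i = u with hB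
  have hAt : ∀ t ∈ Icc 0 T, ∀ i ∈ A, config (γ t) i = config (γ t) j := fun t ht i hi =>
    config_eq_of_isHorizontal hγ hg ((Finset.mem_filter.1 hi).2.trans hj.symm) t ht
  have hBt : ∀ t ∈ Icc 0 T, ∀ i ∈ B, config (γ t) i = config (γ t) k := fun t ht i hi =>
    config_eq_of_isHorizontal hγ hg ((hval i (Finset.mem_filter.1 hi).2).trans hk.symm) t ht
  have hAB : ∀ i, i ∈ A ∨ i ∈ B := fun i => by
    by_cases hi : config (γ 0) i = u <;> simp [hA, hB, hi]
  have hp : 0 < (A.card : ℝ) := by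
    exact_mod_cast Finset.card_pos.2 ⟨j, by simp [hA, hj]⟩
  have hr : 0 < (B.card : ℝ) := by
    exact_mod_cast Finset.card_pos.2 ⟨k, by simp [hB, hk, huv.symm]⟩
  have hsum : ∀ t ∈ Icc 0 T, ((A.card : ℝ) : ℂ) * config (γ t) j
      + ((B.card : ℝ) : ℂ) * config (γ t) k = c t := by
    intro t ht
    rw [← hlift t ht, unitArm_apply,
      ← Finset.sum_filter_add_sum_filter_not Finset.univ (fun i => config (γ 0) i = u),
      Finset.sum_congr rfl fun i hi => by rw [hAt t ht i hi],
      Finset.sum_congr (s₁ := Finset.univ.filter fun i => ¬ config (γ 0) i = u) rfl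
        fun i hi => by rw [hBt t ht i hi]]
    simp [hA, hB]
  -- If the two directions became parallel, all segments would have the same square and the Gram
  -- determinant would vanish.
  have him : ∀ t ∈ Icc 0 T, ((config (γ t) k : ℂ) * conj (config (γ t) j : ℂ)).im ≠ 0 := by
    intro t ht h0
    have hsq := sq_eq_sq_of_im_mul_conj_eq_zero h0
    refine hg t ht (gramDet_eq_zero_of_sq_eq (c := config (γ t) j) fun i => ?_)
    rcases hAB i with hi | hi
    · rw [hAt t ht i hi]
    · rw [hBt t ht i hi, hsq]
  obtain ⟨s, hs, -⟩ := hγ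
  have hcont : ContinuousOn (fun t => ((config (γ t) k : ℂ) * conj (config (γ t) j : ℂ)).im)
      (Icc 0 T) := by
    have : Continuous fun q : EuclideanSpace ℝ (Fin m) =>
        ((config q k : ℂ) * conj (config q j : ℂ)).im :=
      Complex.continuous_im.comp ((contDiff_coe_config k).continuous.mul
        (Complex.continuous_conj.comp (contDiff_coe_config j).continuous))
    exact this.comp_continuousOn hs.1
  have h0T : (0 : ℝ) ∈ Icc 0 T := left_mem_Icc.2 hT
  have hTT : T ∈ Icc 0 T := right_mem_Icc.2 hT
  obtain ⟨h1, h2⟩ := circle_pair_unique hp hr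
    (((hsum 0 h0T).trans (hc.start.trans hc.finish.symm)).trans (hsum T hTT).symm)
    (mul_pos_of_continuousOn_of_ne_zero hT hcont him)
  funext i
  rcases hAB i with hi | hi
  · rw [hAt T hTT i hi, hAt 0 h0T i hi, h1]
  · rw [hBt T hTT i hi, hBt 0 h0T i hi, h2]

end TwoValues

/-! ### Horizontal lifts of segments -/

section Segments

open ComplexConjugate

variable {m : ℕ}

/-- The horizontal lifts of constant vector fields of the plane, cut off by the function `χ`. -/
def liftField (χ : ℂ → ℝ) (q : EuclideanSpace ℝ (Fin m)) : ℂ →L[ℝ] EuclideanSpace ℝ (Fin m) :=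
  χ (angularArm (unitLengths m) q) • (horizontalVector (config q)).comp (covector (config q))

lemma liftField_apply (χ : ℂ → ℝ) (q : EuclideanSpace ℝ (Fin m)) (v : ℂ) :
    liftField χ q v = χ (angularArm (unitLengths m) q) •
      horizontalVector (config q) (covector (config q) v) := rfl

/-- `χ` is a smooth function, supported over non-collinear configurations, and equal to `1` on the
convex set `B`. -/
structure IsCutoff (m : ℕ) (χ : ℂ → ℝ) (B : Set ℂ) : Prop where
  smooth : ContDiff ℝ ∞ χ
  gramDet_ne : ∀ z : Fin m → Circle, arm (unitLengths m) z ∈ tsupport χ → gramDet z ≠ 0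
  convex : Convex ℝ B
  eq_one : ∀ w ∈ B, χ w = 1

lemma exists_isCutoff {U : Set ℂ} (hU : IsOpen U)
    (hreg : ∀ w ∈ U, IsRegularValue (unitLengths m) w) {b : ℂ} (hb : b ∈ U) :
    ∃ χ B, IsCutoff m χ B ∧ IsOpen B ∧ b ∈ B ∧ B ⊆ U := by
  obtain ⟨R, hR, hRU⟩ := Metric.nhds_basis_closedBall.mem_iff.1 (hU.mem_nhds hb)
  let χ : ContDiffBump b := ⟨R / 2, R, half_pos hR, half_lt_self hR⟩
  refine ⟨χ, Metric.ball b (R / 2), ⟨χ.contDiff, fun z hz => ?_, convex_ball _ _, fun w hw => ?_⟩,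
    Metric.isOpen_ball, Metric.mem_ball_self (half_pos hR), ?_⟩
  · rw [χ.tsupport_eq] at hz
    exact (gramDet_pos_of_isRegularValue (hreg _ (hRU hz)) rfl).ne'
  · exact χ.one_of_mem_closedBall (Metric.ball_subset_closedBall hw)
  · exact (Metric.ball_subset_ball (half_le_self hR.le)).trans
      (Metric.ball_subset_closedBall.trans hRU)

variable {χ : ℂ → ℝ} {B : Set ℂ}

/-- Over the support of `χ` the denominator `gramDet` is nonzero; elsewhere the field vanishes on a
neighbourhood, whatever `covector` is there. -/
lemma contDiff_liftField (h : IsCutoff m χ B) :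
    ContDiff ℝ ∞ (liftField (m := m) χ) := by
  rw [contDiff_clm_apply_iff]
  intro v
  rw [contDiff_euclidean]
  intro j
  rw [contDiff_iff_contDiffAt]
  intro q
  by_cases hq : angularArm (unitLengths m) q ∈ tsupport χ
  · have hχ : ContDiffAt ℝ ∞ (fun r : EuclideanSpace ℝ (Fin m) =>
        χ (angularArm (unitLengths m) r)) q := (h.smooth.comp contDiff_angularArm).contDiffAt
    have hcov : ContDiffAt ℝ ∞ (fun r : EuclideanSpace ℝ (Fin m) => covector (config r) v) q := by
      simp only [covector_apply]
      exact (contDiffAt_const.div contDiff_gramDet.contDiffAt (h.gramDet_ne _ hq)).smul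
        (contDiffAt_const.add (contDiff_squareSum.contDiffAt.mul contDiffAt_const))
    have hconj : ContDiffAt ℝ ∞ (fun r : EuclideanSpace ℝ (Fin m) => conj (config r j : ℂ)) q :=
      (Complex.conjCLE.contDiff.comp (contDiff_coe_config j)).contDiffAt
    have him : ContDiffAt ℝ ∞ (fun r : EuclideanSpace ℝ (Fin m) =>
        (covector (config r) v * conj (config r j : ℂ)).im) q :=
      Complex.imCLM.contDiff.contDiffAt.comp q (hcov.mul hconj)
    exact hχ.mul him
  · have hev : ∀ᶠ r in nhds q, angularArm (unitLengths m) r ∉ tsupport χ :=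
      (contDiff_angularArm.continuous.tendsto q).eventually
        ((isClosed_tsupport χ).isOpen_compl.mem_nhds hq)
    refine (contDiffAt_const (c := (0 : ℝ))).congr_of_eventuallyEq ?_
    filter_upwards [hev] with r hr
    rw [liftField_apply, image_eq_zero_of_notMem_tsupport hr, zero_smul]
    rfl

lemma exists_bddBox_config_eq (q : EuclideanSpace ℝ (Fin m)) :
    ∃ p ∈ WithLp.toLp 2 '' (univ.pi fun _ : Fin m => Icc (-Real.pi) Real.pi),
      config p = config q := by
  refine ⟨WithLp.toLp 2 fun j => Complex.arg (config q j), mem_image_of_mem _ fun j _ =>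
    ⟨(Complex.neg_pi_lt_arg _).le, Complex.arg_le_pi _⟩, ?_⟩
  exact funext fun j => Circle.exp_arg (config q j)

lemma liftField_congr {q q' : EuclideanSpace ℝ (Fin m)} (h : config q = config q') :
    liftField χ q = liftField χ q' := by
  simp only [liftField, angularArm, h]

/-- The field depends only on the configuration, so its bound on the compact cube `[-π, π]^m` is
global. -/
lemma exists_bound_liftField (h : IsCutoff m χ B) :
    ∃ C, ∀ q, ‖liftField (m := m) χ q‖ ≤ C := by
  have hK : IsCompact (WithLp.toLp 2 '' (univ.pi fun _ : Fin m => Icc (-Real.pi) Real.pi) :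
      Set (EuclideanSpace ℝ (Fin m))) :=
    (isCompact_univ_pi fun _ => isCompact_Icc).image (PiLp.continuous_toLp 2 _)
  obtain ⟨C, hC⟩ := hK.exists_bound_of_continuousOn (contDiff_liftField h).continuous.continuousOn
  refine ⟨C, fun q => ?_⟩
  obtain ⟨p, hp, hpq⟩ := exists_bddBox_config_eq q
  rw [← liftField_congr hpq]
  exact hC p hp

lemma contDiff_liftField_apply (h : IsCutoff m χ B) (v : ℂ) :
    ContDiff ℝ ∞ (fun q : EuclideanSpace ℝ (Fin m) => liftField χ q v) :=
  (contDiff_liftField h).clm_apply contDiff_const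

lemma exists_bound_liftField_apply (h : IsCutoff m χ B) (v : ℂ) :
    ∃ C, ∀ q : EuclideanSpace ℝ (Fin m), ‖liftField χ q v‖ ≤ C := by
  obtain ⟨C, hC⟩ := exists_bound_liftField h
  exact ⟨C * ‖v‖, fun q => (liftField χ q).le_of_opNorm_le (hC q) v⟩

lemma armDeriv_liftField (h : IsCutoff m χ B) (q : EuclideanSpace ℝ (Fin m)) (v : ℂ) :
    armDeriv q (liftField χ q v) = χ (angularArm (unitLengths m) q) • v := by
  rw [liftField_apply, map_smul]
  by_cases hq : angularArm (unitLengths m) q ∈ tsupport χ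
  · rw [armDeriv_horizontalVector_covector (h.gramDet_ne _ hq)]
  · rw [image_eq_zero_of_notMem_tsupport hq, zero_smul, zero_smul]

lemma segment_mem (h : IsCutoff m χ B) {w w' : ℂ} (hw : w ∈ B) (hw' : w' ∈ B) {t : ℝ}
    (ht : t ∈ Icc (0 : ℝ) 1) : w + t • (w' - w) ∈ B :=
  h.convex.add_smul_sub_mem hw hw' ht

/-- The image of `γ` in the plane is an integral curve of `χ • (w' - w)`. So is the segment, which
stays in the convex set where `χ = 1`; uniqueness identifies them. -/
lemma angularArm_isIntegralCurveOn (h : IsCutoff m χ B) {w w' : ℂ} (hw : w ∈ B) (hw' : w' ∈ B)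
    {γ : ℝ → EuclideanSpace ℝ (Fin m)} (h0 : angularArm (unitLengths m) (γ 0) = w)
    (hγ : IsIntegralCurveOn γ (fun _ q => liftField χ q (w' - w)) (Icc 0 1)) :
    ∀ t ∈ Icc (0 : ℝ) 1, angularArm (unitLengths m) (γ t) = w + t • (w' - w) := by
  have hX : ContDiff ℝ 1 (fun y => χ y • (w' - w)) :=
    (h.smooth.of_le (by simp)).smul contDiff_const
  refine eqOn_of_isIntegralCurveOn hX (fun t ht => ?_) (fun t ht => ?_) (by simp [h0])
  · have := (hasFDerivAt_angularArm (γ t)).comp_hasDerivWithinAt t (hγ t ht)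
    rw [armDeriv_liftField h] at this
    exact this
  · simp only [h.eq_one _ (segment_mem h hw hw' ht)]
    simpa using (((hasDerivAt_id t).smul_const (w' - w)).const_add w).hasDerivWithinAt

lemma isHorizontal_of_isIntegralCurveOn (h : IsCutoff m χ B) {v : ℂ}
    {γ : ℝ → EuclideanSpace ℝ (Fin m)}
    (hγ : IsIntegralCurveOn γ (fun _ q => liftField χ q v) (Icc 0 1)) :
    IsHorizontal (unitLengths m) 1 γ := by
  have hs : ContDiffOn ℝ ∞ γ (Icc 0 1) :=
    ODE.contDiffOn_enat_Icc_of_hasDerivWithinAt (f := fun _ q => liftField χ q v) (u := univ)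
      (n := ⊤) ((contDiff_liftField_apply h v).comp contDiff_snd).contDiffOn hγ (mapsTo_univ _ _)
  refine ⟨∅, ⟨hs.continuousOn, fun x y hx _ hy _ => hs.mono (Icc_subset_Icc hx hy)⟩,
    fun t ht _ => ?_⟩
  rw [((hγ t (Ioo_subset_Icc_self ht)).hasDerivAt (Icc_mem_nhds ht.1 ht.2)).deriv]
  exact Submodule.smul_mem _ _ (horizontalVector_mem _ _)

/-- Transport of a configuration along the horizontal lift of a segment of direction `v`. -/
def segmentMap (χ : ℂ → ℝ) (v : ℂ) (z : Fin m → Circle) : Fin m → Circle :=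
  config (timeOne (fun q => liftField χ q v) (Function.surjInv config_surjective z))

/-- Periodicity of the field removes the dependence on the chosen angular lift. -/
lemma segmentMap_config (h : IsCutoff m χ B) (v : ℂ) (q : EuclideanSpace ℝ (Fin m)) :
    segmentMap χ v (config q) = config (timeOne (fun q => liftField χ q v) q) := by
  obtain ⟨C, hC⟩ := exists_bound_liftField_apply h v
  obtain ⟨p, hp, hper⟩ := exists_period (Function.surjInv_eq config_surjective (config q))
  rw [segmentMap, ← hp, timeOne_add ((contDiff_liftField_apply h v).of_le (by simp)) hC
    (fun r => by rw [liftField_congr (hper r)]), hper]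

lemma segmentMap_neg_segmentMap (h : IsCutoff m χ B) (v : ℂ) (z : Fin m → Circle) :
    segmentMap χ (-v) (segmentMap χ v z) = z := by
  obtain ⟨C, hC⟩ := exists_bound_liftField_apply h v
  obtain ⟨q, rfl⟩ := config_surjective z
  rw [segmentMap_config h, segmentMap_config h]
  simp only [map_neg]
  rw [timeOne_neg_timeOne ((contDiff_liftField_apply h v).of_le (by simp)) hC]

lemma horizontalLift_segmentMap (h : IsCutoff m χ B) {w w' : ℂ} (hw : w ∈ B) (hw' : w' ∈ B)
    {z : Fin m → Circle} (hz : arm (unitLengths m) z = w) :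
    HorizontalLift (unitLengths m) 1 (fun t => w + t • (w' - w)) z (segmentMap χ (w' - w) z) := by
  obtain ⟨C, hC⟩ := exists_bound_liftField_apply h (w' - w)
  obtain ⟨q, rfl⟩ := config_surjective z
  obtain ⟨γ, h0, h1, hγ⟩ := exists_isIntegralCurveOn_timeOne
    ((contDiff_liftField_apply h (w' - w)).of_le (by simp)) hC q
  rw [segmentMap_config h, ← h1]
  exact ⟨γ, isHorizontal_of_isIntegralCurveOn h hγ,
    angularArm_isIntegralCurveOn h hw hw' (by rw [h0]; exact hz) hγ, by rw [h0], rfl⟩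

lemma arm_segmentMap (h : IsCutoff m χ B) {w w' : ℂ} (hw : w ∈ B) (hw' : w' ∈ B)
    {z : Fin m → Circle} (hz : arm (unitLengths m) z = w) :
    arm (unitLengths m) (segmentMap χ (w' - w) z) = w' := by
  obtain ⟨γ, -, hlift, -, h1⟩ := horizontalLift_segmentMap h hw hw' hz
  rw [← h1, hlift 1 (by simp)]
  simp

/-- Transport between the fibres over the end points of a segment. -/
def segmentEquiv (h : IsCutoff m χ B) {w w' : ℂ} (hw : w ∈ B) (hw' : w' ∈ B) :
    Fiber (unitLengths m) w ≃ Fiber (unitLengths m) w' where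
  toFun z := ⟨segmentMap χ (w' - w) z.1, arm_segmentMap h hw hw' z.2⟩
  invFun z := ⟨segmentMap χ (w - w') z.1, arm_segmentMap h hw' hw z.2⟩
  left_inv z := Subtype.ext (by
    simpa only [neg_sub] using segmentMap_neg_segmentMap h (w' - w) z.1)
  right_inv z := Subtype.ext (by
    simpa only [neg_sub] using segmentMap_neg_segmentMap h (w - w') z.1)

lemma smoothOffBreaks_segment (w w' : ℂ) :
    SmoothOffBreaks ∅ 1 (fun t : ℝ => w + t • (w' - w)) := by
  have : ContDiff ℝ ∞ (fun t : ℝ => w + t • (w' - w)) := by fun_prop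
  exact ⟨this.continuous.continuousOn, fun _ _ _ _ _ _ => this.contDiffOn⟩

lemma concat_mem {E : Type*} {B : Set E} {T S : ℝ} {c d : ℝ → E} (hcd : c T = d 0)
    (hc : ∀ t ∈ Icc 0 T, c t ∈ B) (hd : ∀ t ∈ Icc 0 S, d t ∈ B) :
    ∀ t ∈ Icc 0 (T + S), concat T c d t ∈ B := by
  intro t ht
  rcases le_total t T with h | h
  · rw [concat_left h]
    exact hc t ⟨ht.1, h⟩
  · rw [concat_right hcd h]
    exact hd _ ⟨by linarith, by linarith [ht.2]⟩

/-- Transport around a triangle belongs to the holonomy group. -/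
lemma triangle_mem_holonomyGroup (h : IsCutoff m χ B) {U : Set ℂ} (hBU : B ⊆ U) {b w w' : ℂ}
    (hb : b ∈ B) (hw : w ∈ B) (hw' : w' ∈ B) :
    ((segmentEquiv h hb hw).trans (segmentEquiv h hw hw')).trans (segmentEquiv h hw' hb) ∈
      holonomyGroup (unitLengths m) U b (hBU hb) := by
  have j1 : (fun t : ℝ => b + t • (w - b)) 1 = (fun t : ℝ => w + t • (w' - w)) 0 := by simp
  have j2 : concat 1 (fun t : ℝ => b + t • (w - b)) (fun t : ℝ => w + t • (w' - w)) (1 + 1)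
      = (fun t : ℝ => w' + t • (b - w')) 0 := by
    rw [concat_right j1 (by norm_num)]; simp
  have hs := smoothOffBreaks_concat zero_le_one zero_le_one j1 (smoothOffBreaks_segment b w)
    (smoothOffBreaks_segment w w')
  refine ⟨1 + 1 + 1, concat (1 + 1) (concat 1 (fun t : ℝ => b + t • (w - b))
    (fun t : ℝ => w + t • (w' - w))) (fun t : ℝ => w' + t • (b - w')),
    ⟨by norm_num, ⟨_, smoothOffBreaks_concat (by norm_num) zero_le_one j2 hs
      (smoothOffBreaks_segment w' b)⟩, fun t ht => hBU ?_, ?_, ?_⟩, fun z => ?_⟩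
  · exact concat_mem j2 (concat_mem j1 (fun t ht => segment_mem h hb hw ht)
      fun t ht => segment_mem h hw hw' ht) (fun t ht => segment_mem h hw' hb ht) t ht
  · rw [concat_left (by norm_num), concat_left (by norm_num)]; simp
  · rw [concat_right j2 (by norm_num)]; simp
  · exact horizontalLift_concat (by norm_num) zero_le_one j2
      (horizontalLift_concat zero_le_one zero_le_one j1 (horizontalLift_segmentMap h hb hw z.2)
        (horizontalLift_segmentMap h hw hw' (arm_segmentMap h hb hw z.2)))
      (horizontalLift_segmentMap h hw' hb
        (arm_segmentMap h hw hw' (arm_segmentMap h hb hw z.2)))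

/-- Undo the last edge of the triangle `b, w, w'`: transport of a fixed point within `B` does not
depend on which of the two paths is taken. -/
lemma segmentMap_segmentMap_of_mem_fixedPoints (h : IsCutoff m χ B) {U : Set ℂ} (hBU : B ⊆ U)
    {b w w' : ℂ} (hb : b ∈ B) (hw : w ∈ B) (hw' : w' ∈ B) {z : Fiber (unitLengths m) b}
    (hz : z ∈ MulAction.fixedPoints (holonomyGroup (unitLengths m) U b (hBU hb))
      (Fiber (unitLengths m) b)) :
    segmentMap χ (w' - w) (segmentMap χ (w - b) z.1) = segmentMap χ (w' - b) z.1 := by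
  have h1 : segmentMap χ (b - w') (segmentMap χ (w' - w) (segmentMap χ (w - b) z.1)) = z.1 :=
    congrArg Subtype.val (hz ⟨_, triangle_mem_holonomyGroup h hBU hb hw hw'⟩)
  have h2 := segmentMap_neg_segmentMap h (b - w')
    (segmentMap χ (w' - w) (segmentMap χ (w - b) z.1))
  rw [h1, neg_sub] at h2
  exact h2.symm

end Segments

/-! ### Fixed configurations have two values -/

section Fixed

open ComplexConjugate

variable {m : ℕ} {χ : ℂ → ℝ} {B : Set ℂ}

lemma covector_eq (z : Fin m → Circle) :
    covector z = (2 / gramDet z) • ((m : ℂ) • ContinuousLinearMap.id ℝ ℂ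
      + squareSum z • (Complex.conjCLE : ℂ →L[ℝ] ℂ)) := rfl

lemma differentiableAt_covector {Z : ℂ → Fin m → Circle} {b : ℂ}
    (hZ : ∀ j, DifferentiableAt ℝ (fun w => (Z w j : ℂ)) b) (hb : gramDet (Z b) ≠ 0) :
    DifferentiableAt ℝ (fun w => covector (Z w)) b := by
  have hS : DifferentiableAt ℝ (fun w => squareSum (Z w)) b :=
    DifferentiableAt.fun_sum fun j _ => (hZ j).pow 2
  have hG : DifferentiableAt ℝ (fun w => gramDet (Z w)) b := by
    simp only [gramDet, Complex.normSq_eq_norm_sq]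
    exact (differentiableAt_const _).sub (hS.norm_sq ℝ)
  simp only [covector_eq]
  have hd : DifferentiableAt ℝ (fun w => 2 / gramDet (Z w)) b := by fun_prop (disch := exact hb)
  exact hd.fun_smul ((differentiableAt_const _).fun_add (hS.smul_const _))

/-- The velocity of the `j`-th segment in the horizontal lifts of the plane vectors. -/
def segmentVelocity (z : Fin m → Circle) (j : Fin m) : ℂ →L[ℝ] ℂ :=
  (2⁻¹ : ℝ) • (covector z - ((z j : ℂ) ^ 2) • (Complex.conjCLE : ℂ →L[ℝ] ℂ).comp (covector z))

lemma segmentVelocity_apply (z : Fin m → Circle) (j : Fin m) (v : ℂ) :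
    segmentVelocity z j v = (covector z v - (z j : ℂ) ^ 2 * conj (covector z v)) / 2 := by
  simp [segmentVelocity]
  ring

/-- An integral section of the horizontal distribution takes at most two values: its second
derivatives are symmetric, so the segments are roots of one quadratic polynomial. -/
lemma exists_quadratic_of_horizontal_section {Z : ℂ → Fin m → Circle} {b : ℂ}
    (hZ : ∀ᶠ w in nhds b, ∀ j, HasFDerivAt (fun w => (Z w j : ℂ)) (segmentVelocity (Z w) j) w)
    (hb : gramDet (Z b) ≠ 0) :
    ∃ β : ℂ, ∀ j, β - conj β * (Z b j : ℂ) ^ 2 - 2 * Complex.I * Z b j = 0 := by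
  have hZb := hZ.self_of_nhds
  have hL := (differentiableAt_covector (fun j => (hZb j).differentiableAt) hb).hasFDerivAt
  set A := fderiv ℝ (fun w => covector (Z w)) b with hA
  -- The directions `v, u` are the images of `1, i` under `D D*`, so that `L v = 1` and `L u = i`.
  set v := ((m : ℂ) * 1 - squareSum (Z b) * conj 1) / 2 with hv
  set u := ((m : ℂ) * Complex.I - squareSum (Z b) * conj Complex.I) / 2 with hu
  have hLv : covector (Z b) v = 1 := covector_right_inv hb 1
  have hLu : covector (Z b) u = Complex.I := covector_right_inv hb Complex.I
  -- `β` is the exterior derivative of the form `L` at `b`, evaluated on `(u, v)`; it does not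
  -- involve `j`.
  refine ⟨A u v - A v u, fun j => ?_⟩
  have hV : DifferentiableAt ℝ (fun w => segmentVelocity (Z w) j) b := by
    have hc : DifferentiableAt ℝ
        (fun w => (Complex.conjCLE : ℂ →L[ℝ] ℂ).comp (covector (Z w))) b :=
      (differentiableAt_const _).clm_comp hL.differentiableAt
    have hq : DifferentiableAt ℝ (fun w => (Z w j : ℂ) ^ 2) b := (hZb j).differentiableAt.pow 2
    exact (hL.differentiableAt.fun_sub (hq.fun_smul hc)).fun_const_smul (2⁻¹ : ℝ)
  have happ : ∀ x y : ℂ, fderiv ℝ (fun w => segmentVelocity (Z w) j) b x y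
      = (A x y - ((Z b j : ℂ) ^ 2 * conj (A x y)
        + 2 * (Z b j : ℂ) * segmentVelocity (Z b) j x * conj (covector (Z b) y))) / 2 := by
    intro x y
    have h1 : HasFDerivAt (fun w => segmentVelocity (Z w) j y) _ b :=
      hV.hasFDerivAt.clm_apply (hasFDerivAt_const y b)
    have h2 : HasFDerivAt (fun w => covector (Z w) y) _ b := hL.clm_apply (hasFDerivAt_const y b)
    have h3 := ((h2.sub (((hZb j).pow 2).mul
      ((Complex.conjCLE : ℂ →L[ℝ] ℂ).hasFDerivAt.comp b h2))).mul_const (2⁻¹ : ℂ))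
    have h4 := (h1.congr_of_eventuallyEq (Filter.Eventually.of_forall fun w => ?_)).unique h3
    · have := congrArg (fun T : ℂ →L[ℝ] ℂ => T x) h4
      simp at this
      rw [this]
      ring
    · simp [segmentVelocity_apply]
      ring
  -- On antisymmetrising, the cubic terms in `z_j` cancel and `L u * conj (L v) - L v * conj (L u) =
  -- 2 i` supplies the linear term.
  have hsymm := second_derivative_symmetric_of_eventually_of_real
    (hZ.mono fun w hw => hw j) hV.hasFDerivAt u v
  rw [happ, happ, segmentVelocity_apply, segmentVelocity_apply, hLu, hLv] at hsymm
  simp only [map_one, Complex.conj_I, map_sub] at hsymm ⊢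
  linear_combination 2 * hsymm

/-- The linear coefficient `-2 i` keeps the polynomial nonzero even when `β = 0`. -/
lemma ncard_range_le_two_of_quadratic {z : Fin m → Circle} {β : ℂ}
    (h : ∀ j, β - conj β * (z j : ℂ) ^ 2 - 2 * Complex.I * z j = 0) : (range z).ncard ≤ 2 := by
  by_contra! hlt
  obtain ⟨x, y, w, ⟨i, rfl⟩, ⟨j, rfl⟩, ⟨k, rfl⟩, hij, hik, hjk⟩ := (two_lt_ncard_iff).1 hlt
  have sub_ne : ∀ {p r : Circle}, p ≠ r → (p : ℂ) - r ≠ 0 := fun hpr h0 =>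
    hpr (Circle.ext (sub_eq_zero.1 h0))
  have h1 : conj β * ((z i : ℂ) + z j) + 2 * Complex.I = 0 :=
    mul_left_cancel₀ (sub_ne hij) (by linear_combination h j - h i)
  have h2 : conj β * ((z i : ℂ) + z k) + 2 * Complex.I = 0 :=
    mul_left_cancel₀ (sub_ne hik) (by linear_combination h k - h i)
  have h3 : conj β = 0 := mul_right_cancel₀ (sub_ne hjk) (by linear_combination h1 - h2)
  rw [h3, zero_mul, zero_add] at h1
  simp at h1

lemma two_le_ncard_range {z : Fin m → Circle} (hz : gramDet z ≠ 0) : 2 ≤ (range z).ncard := by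
  by_contra! hlt
  have hs := (ncard_le_one (finite_range z)).1 (Nat.le_of_lt_succ hlt)
  refine hz ?_
  rcases isEmpty_or_nonempty (Fin m) with he | ⟨⟨i⟩⟩
  · exact gramDet_eq_zero_of_sq_eq (c := 1) fun j => he.elim j
  · exact gramDet_eq_zero_of_sq_eq (c := z i) fun j => by
      rw [hs _ (mem_range_self j) _ (mem_range_self i)]

lemma hasFDerivAt_segmentMap (h : IsCutoff m χ B) {z : Fin m → Circle}
    (hz : arm (unitLengths m) z ∈ B) (j : Fin m) :
    HasFDerivAt (fun v => (segmentMap χ v z j : ℂ)) (segmentVelocity z j) 0 := by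
  obtain ⟨C, hC⟩ := exists_bound_liftField h
  obtain ⟨q, rfl⟩ := config_surjective z
  have h1 := hasFDerivAt_timeOne ((contDiff_liftField h).of_le (by simp)) hC q
  have h0 : timeOne (fun r => liftField χ r 0) q = q := by
    have : IsIntegralCurveOn (fun _ : ℝ => q) (fun _ r => liftField χ r 0) (Icc 0 1) := by
      intro t _
      simpa using hasDerivWithinAt_const t (Icc (0 : ℝ) 1) q
    exact timeOne_eq ((contDiff_liftField_apply h 0).of_le (by simp)) this
  have h2 := hasFDerivAt_coe_config (timeOne (fun r => liftField χ r 0) q) j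
  have h3 := h2.comp (0 : ℂ) h1
  simp only [segmentMap_config h]
  refine h3.congr_fderiv (ContinuousLinearMap.ext fun v => ?_)
  have hχ : χ (angularArm (unitLengths m) q) = 1 := h.eq_one _ hz
  rw [segmentVelocity_apply, ← horizontalVector_mul_I_mul, h0]
  simp [liftField_apply, hχ]

lemma ncard_range_of_mem_fixedPoints (h : IsCutoff m χ B) (hB : IsOpen B) {U : Set ℂ}
    (hBU : B ⊆ U) {b : ℂ} (hb : b ∈ B) {z : Fiber (unitLengths m) b} (hg : gramDet z.1 ≠ 0)
    (hz : z ∈ MulAction.fixedPoints (holonomyGroup (unitLengths m) U b (hBU hb))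
      (Fiber (unitLengths m) b)) :
    (range z.1).ncard = 2 := by
  -- Transport by `0` is its own inverse, and the degenerate triangle at `b` shows that applying it
  -- twice to `z` is the same as applying it once.
  have hb0 : segmentMap χ (b - b) z.1 = z.1 := by
    have h1 := segmentMap_segmentMap_of_mem_fixedPoints h hBU hb hb hb hz
    have h2 := segmentMap_neg_segmentMap h 0 z.1
    rw [sub_self] at h1 ⊢
    rw [neg_zero] at h2
    rw [← h1, h2]
  have hZ : ∀ᶠ w in nhds b, ∀ j, HasFDerivAt (fun w => (segmentMap χ (w - b) z.1 j : ℂ))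
      (segmentVelocity (segmentMap χ (w - b) z.1) j) w := by
    -- Triangle invariance rewrites `Z w'` near `w` as the transport of `Z w` by `w' - w`, so only
    -- the derivative of the transport at zero displacement is needed.
    filter_upwards [hB.mem_nhds hb] with w hw j
    have harm : arm (unitLengths m) (segmentMap χ (w - b) z.1) ∈ B := by
      rwa [arm_segmentMap h hb hw z.2]
    have h1 := hasFDerivAt_segmentMap h harm j
    have hsub : HasFDerivAt (fun w' : ℂ => w' - w) (ContinuousLinearMap.id ℝ ℂ) w :=
      (hasFDerivAt_id w).sub_const w
    have h2 := HasFDerivAt.comp (f := fun w' : ℂ => w' - w) w (by rwa [sub_self]) hsub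
    refine h2.congr_of_eventuallyEq ?_
    filter_upwards [hB.mem_nhds hw] with w' hw'
    rw [← segmentMap_segmentMap_of_mem_fixedPoints h hBU hb hw hw' hz]
    rfl
  obtain ⟨β, hβ⟩ := exists_quadratic_of_horizontal_section hZ (by rwa [hb0])
  rw [hb0] at hβ
  exact le_antisymm (ncard_range_le_two_of_quadratic hβ) (two_le_ncard_range hg)

end Fixed

end

end PlanarArm

theorem proposition7p4 (m : ℕ) (U : Set ℂ) (hU : IsOpen U)
    (hreg : ∀ w ∈ U, PlanarArm.IsRegularValue (fun _ : Fin m => (1 : ℝ)) w)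
    (b : ℂ) (hb : b ∈ U) :
    MulAction.fixedPoints (PlanarArm.holonomyGroup (fun _ : Fin m => (1 : ℝ)) U b hb)
        (PlanarArm.Fiber (fun _ : Fin m => (1 : ℝ)) b) =
      {z | (Set.range z.1).ncard = 2} := by
  ext z
  constructor
  · intro hz
    obtain ⟨χ, B, h, hB, hbB, hBU⟩ := PlanarArm.exists_isCutoff hU hreg hb
    exact PlanarArm.ncard_range_of_mem_fixedPoints h hB hBU hbB
      (PlanarArm.gramDet_pos_of_isRegularValue (hreg b hb) z.2).ne' hz
  · rintro hz ⟨φ, T, c, hc, hφ⟩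
    exact Subtype.ext (PlanarArm.eq_of_horizontalLift_of_ncard_eq_two hreg hc hz (hφ z))
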